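/- Let $R$ be a commutative noetherian ring, let $I,J$ be ideals of $R$, and let $\mathcal{S}$ be a Serre class of $R$-modules (a class containing $0$ and closed under submodules, quotients and extensions). Put $$W(I,J)=\{\mathfrak{p}\in\operatorname{Spec}(R)\mid I^n\subseteq\mathfrak{p}+J\text{ for some integer }n\ge 1\},$$ for an $R$-module $X$ let $\Gamma_{I,J}(X)=\{x\in X\mid \operatorname{Supp}_R(Rx)\subseteq W(I,J)\}$, and let $H^n_{I,J}$ be the $n$-th right derived functor of $\Gamma_{I,J}$. An $R$-module is called minimax if it has a finitely generated submodule with artinian quotient. Suppose that $R/\mathfrak{m}\in\mathcal{S}$ for all $\mathfrak{m}\in\operatorname{Max}(R)$. Let $M$ be a minimax $R$-module and let $t\ge 0$ be an integer such that $\operatorname{Ext}^{n-j}_R\big(R/\mathfrak{m},H^j_{I,J}(M)\big)\in\mathcal{S}$ for $n=t,\,t+1$, all integers $0\le j<t$, and all $\mathfrak{m}\in\operatorname{Max}(R)$. Then for every submodule $N$ of $H^t_{I,J}(M)$ and every $\mathfrak{m}\in\operatorname{Max}(R)\cap W(I,J)$ with $\operatorname{Ext}^1_R(R/\mathfrak{m},N)\in\mathcal{S}$,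 we have $$\operatorname{Hom}_R\big(R/\mathfrak{m},H^t_{I,J}(M)/N\big)\in\mathcal{S}.$$ -/

import Mathlib

universe u

open CategoryTheory

noncomputable section

namespace PairOfIdeals

variable {R : Type u} [CommRing R]

/-- `W(I, J)`: the primes `𝔭` of `R` with `I ^ n ⊆ 𝔭 + J` for some `n ≥ 1`. -/
def W (I J : Ideal R) : Set (PrimeSpectrum R) :=
  {p | ∃ n : ℕ, 1 ≤ n ∧ I ^ n ≤ p.asIdeal + J}

/-- The `(I, J)`-torsion submodule `Γ_{I,J}(M)`: the elements `x` of `M` with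
`Supp (R x) ⊆ W(I, J)`. -/
def torsion (I J : Ideal R) (M : Type u) [AddCommGroup M] [Module R M] : Submodule R M where
  carrier := {x | Module.support R (Submodule.span R {x}) ⊆ W I J}
  zero_mem' := by
    have : Subsingleton (Submodule.span R {(0 : M)}) := by
      rw [Submodule.span_zero_singleton]; infer_instance
    change Module.support R (Submodule.span R {(0 : M)}) ⊆ W I J
    rw [Module.support_eq_empty]
    exact Set.empty_subset _
  add_mem' := by
    intro x y hx hy p hp
    by_contra hW
    obtain ⟨a, ha, hax⟩ : ∃ a ∉ p.asIdeal, a • x = 0 := by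
      by_contra! h
      refine hW (hx (Module.mem_support_iff'.mpr
        ⟨⟨x, Submodule.mem_span_singleton_self x⟩, fun r hr h0 => h r hr ?_⟩))
      simpa using congrArg Subtype.val h0
    obtain ⟨b, hb, hby⟩ : ∃ b ∉ p.asIdeal, b • y = 0 := by
      by_contra! h
      refine hW (hy (Module.mem_support_iff'.mpr
        ⟨⟨y, Submodule.mem_span_singleton_self y⟩, fun r hr h0 => h r hr ?_⟩))
      simpa using congrArg Subtype.val h0
    obtain ⟨⟨z, hz⟩, hz'⟩ := Module.mem_support_iff'.mp hp
    obtain ⟨c, rfl⟩ := Submodule.mem_span_singleton.mp hz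
    refine hz' (a * b) (p.isPrime.mul_notMem ha hb) (Subtype.ext ?_)
    change (a * b) • c • (x + y) = 0
    have h1 : (a * b) • c • x = 0 := by
      rw [show (a * b) • c • x = (b * c) • a • x by simp only [smul_smul]; congr 1; ring, hax,
        smul_zero]
    have h2 : (a * b) • c • y = 0 := by
      rw [show (a * b) • c • y = (a * c) • b • y by simp only [smul_smul]; congr 1; ring, hby,
        smul_zero]
    rw [smul_add, smul_add, h1, h2, add_zero]
  smul_mem' := by
    intro r x hx
    exact (Module.support_subset_of_injective
      (Submodule.inclusion (Submodule.span_singleton_smul_le R r x))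
      (Submodule.inclusion_injective _)).trans hx

theorem map_mem_torsion (I J : Ideal R) {M N : Type u} [AddCommGroup M] [Module R M]
    [AddCommGroup N] [Module R N] (f : M →ₗ[R] N) {x : M} (hx : x ∈ torsion I J M) :
    f x ∈ torsion I J N := by
  intro p hp
  refine hx ?_
  obtain ⟨⟨z, hz⟩, hz'⟩ := Module.mem_support_iff'.mp hp
  obtain ⟨c, rfl⟩ := Submodule.mem_span_singleton.mp hz
  refine Module.mem_support_iff'.mpr
    ⟨⟨c • x, Submodule.smul_mem _ _ (Submodule.mem_span_singleton_self x)⟩, fun r hr h0 =>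
      hz' r hr (Subtype.ext ?_)⟩
  have h1 : r • c • x = 0 := congrArg Subtype.val h0
  change r • c • f x = 0
  rw [← map_smul, ← map_smul, h1, map_zero]

/-- The `(I, J)`-torsion functor `Γ_{I,J}` on `R`-modules; on morphisms it is restriction. -/
def torsionFunctor (I J : Ideal R) : ModuleCat.{u} R ⥤ ModuleCat.{u} R where
  obj M := ModuleCat.of R (torsion I J M)
  map f := ModuleCat.ofHom (f.hom.restrict fun _ hx => map_mem_torsion I J f.hom hx)

instance (I J : Ideal R) : (torsionFunctor I J).Additive where

/-- `H^n_{I,J}(M)`, the value at `M` of the `n`-th right derived functor of `Γ_{I,J}`. -/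
def localCohomology (I J : Ideal R) (n : ℕ) (M : ModuleCat.{u} R) : ModuleCat.{u} R :=
  ((torsionFunctor I J).rightDerived n).obj M

end PairOfIdeals

/-- A module is minimax if it has a finitely generated submodule with artinian quotient. -/
def IsMinimax (R : Type u) [CommRing R] (M : Type u) [AddCommGroup M] [Module R M] : Prop :=
  ∃ N : Submodule R M, N.FG ∧ IsArtinian R (M ⧸ N)

/-- The `R`-module `Ext^n_R(L, X)`. -/
abbrev extModule {R : Type u} [CommRing R] (L X : Type u) [AddCommGroup L] [Module R L]
    [AddCommGroup X] [Module R X] (n : ℕ) : ModuleCat.{u} R :=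
  ModuleCat.of R (Abelian.Ext (ModuleCat.of R L) (ModuleCat.of R X) n)

end

/-!
Let `k = R / m`. By the exact sequence `Hom(k, H) → Hom(k, H / N) → Ext¹(k, N)` for
`H = H^t_{I,J}(M)` it is enough that `Hom(k, H)` lies in `S`. One would read this off the spectral
sequence `Ext^p(k, H^q_{I,J}(M)) ⇒ Ext^{p+q}(k, M)`; here the one corner of it that matters is
treated by hand.

Let `P` be an injective resolution of `M` and `C = Γ_{I,J}(P)`, with cycles `Z`, boundaries `B` and
homology `H`, so that `H^j(C) = H^j_{I,J}(M)`. Two facts relate `C` and `P`.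
* `C` again consists of injectives, because `Γ_{I,J}` preserves injectives over a noetherian ring;
  this follows from Baer's criterion and the Artin–Rees lemma
  (`PairOfIdeals.injective_torsion`).
* `Hom(k, C) = Hom(k, P)`, since `m ∈ W(I, J)` makes everything killed by `m` torsion
  (`PairOfIdeals.apply_mem_torsion_of_mem_W`).

In the exact sequence `Hom(k, Z^t(C)) → Hom(k, H^t(C)) → Ext¹(k, B^t(C))` both ends are under control.
Dimension shifting along `0 → Z^j → C^j → B^{j+1} → 0` and `0 → B^j → Z^j → H^j → 0`
(`CochainComplex.serre_ext_boundaries`) puts `Ext¹(k, B^t(C))` in `S`, because the modules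
`Ext^{t+1-j}(k, H^j(C))` with `j < t` are in `S`. The image of the first map is a subquotient of
`Ext¹(k, Z^{t-1}(P))`, or of `Hom(k, M)` if `t = 0`: a map `k → Z^t(C)` which lifts to `P^{t-1}` lifts
to `C^{t-1}`, and so vanishes in homology. Dimension shifting along the exact complex `P` reduces
these modules to `Ext^n(k, M)` (`CochainComplex.serre_ext_zero_homology`).

Finally `Ext^n(k, M)` has finite length for minimax `M`, so it lies in `S`, which contains all simple
modules (`serre_ext_of_isMinimax`).
-/

/-! ### Serre classes and `Ext` of modules -/

section SerreClass

variable {R : Type u} [CommRing R] (S : ObjectProperty (ModuleCat.{u} R)) [S.IsSerreClass]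

theorem serre_of_injective {A B : Type u} [AddCommGroup A] [Module R A] [AddCommGroup B]
    [Module R B] (f : A →ₗ[R] B) (hf : Function.Injective f) (hB : S (ModuleCat.of R B)) :
    S (ModuleCat.of R A) :=
  have : Mono (ModuleCat.ofHom f) := (ModuleCat.mono_iff_injective _).mpr hf
  S.prop_of_mono (ModuleCat.ofHom f) hB

theorem serre_of_surjective {A B : Type u} [AddCommGroup A] [Module R A] [AddCommGroup B]
    [Module R B] (f : A →ₗ[R] B) (hf : Function.Surjective f) (hA : S (ModuleCat.of R A)) :
    S (ModuleCat.of R B) :=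
  have : Epi (ModuleCat.ofHom f) := (ModuleCat.epi_iff_surjective _).mpr hf
  S.prop_of_epi (ModuleCat.ofHom f) hA

theorem serre_of_exact {A B C : Type u} [AddCommGroup A] [Module R A] [AddCommGroup B]
    [Module R B] [AddCommGroup C] [Module R C] (f : A →ₗ[R] B) (g : B →ₗ[R] C)
    (h : Function.Exact f g) (hA : S (ModuleCat.of R A)) (hC : S (ModuleCat.of R C)) :
    S (ModuleCat.of R B) :=
  S.prop_X₂_of_exact (ModuleCat.shortComplex_exact
    (ModuleCat.shortComplexOfCompEqZero f g h.linearMap_comp_eq_zero) h) hA hC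

theorem serre_of_subsingleton (A : Type u) [AddCommGroup A] [Module R A] [Subsingleton A] :
    S (ModuleCat.of R A) :=
  S.prop_of_isZero (ModuleCat.isZero_of_subsingleton _)

/-- If `A → B → C` is exact, it is enough that `C` and the image of `A` in `B` lie in the Serre
class; the latter is a quotient of a submodule of `E`. -/
theorem serre_of_exact_of_ker_le {A B C E : Type u} [AddCommGroup A] [Module R A]
    [AddCommGroup B] [Module R B] [AddCommGroup C] [Module R C] [AddCommGroup E] [Module R E]
    (f : A →ₗ[R] B) (g : B →ₗ[R] C) (h : Function.Exact f g) (δ : A →ₗ[R] E)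
    (hδ : LinearMap.ker δ ≤ LinearMap.ker f) (hE : S (ModuleCat.of R E))
    (hC : S (ModuleCat.of R C)) : S (ModuleCat.of R B) := by
  have h1 : S (ModuleCat.of R (A ⧸ LinearMap.ker δ)) :=
    serre_of_injective S ((LinearMap.ker δ).liftQ δ le_rfl)
      (LinearMap.ker_eq_bot.mp (Submodule.ker_liftQ_eq_bot' _ _ rfl)) hE
  refine serre_of_exact S ((LinearMap.ker δ).liftQ f hδ) g (fun x => ?_) h1 hC
  rw [h x, ← LinearMap.coe_range, ← LinearMap.coe_range, Submodule.range_liftQ]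

theorem serre_of_isFiniteLength (hS : ∀ m : MaximalSpectrum R, S (ModuleCat.of R (R ⧸ m.asIdeal)))
    {A : Type u} [AddCommGroup A] [Module R A] (hA : IsFiniteLength R A) :
    S (ModuleCat.of R A) := by
  induction hA with
  | of_subsingleton => exact serre_of_subsingleton S _
  | @of_simple_quotient A _ _ N hN _ ih =>
    obtain ⟨a, ha, ⟨e⟩⟩ := isSimpleModule_iff_quot_maximal.mp hN
    have h1 : S (ModuleCat.of R (A ⧸ N)) :=
      serre_of_injective S e.toLinearMap e.injective (hS ⟨a, ha⟩)
    exact serre_of_exact S N.subtype N.mkQ (LinearMap.exact_subtype_mkQ N) ih h1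

end SerreClass

section Ext

open Abelian

variable {R : Type u} [CommRing R] (L : ModuleCat.{u} R)

variable (S : ObjectProperty (ModuleCat.{u} R)) [S.IsSerreClass]

theorem serre_ext_of_iso {X Y : ModuleCat.{u} R} (e : X ≅ Y) {n : ℕ}
    (h : S (ModuleCat.of R (Ext L X n))) : S (ModuleCat.of R (Ext L Y n)) := by
  refine serre_of_surjective S ((Ext.mk₀ e.hom).postcompOfLinear R L (add_zero n)) (fun y => ?_) h
  refine ⟨y.comp (Ext.mk₀ e.inv) (add_zero n), ?_⟩
  change (y.comp (Ext.mk₀ e.inv) (add_zero n)).comp (Ext.mk₀ e.hom) (add_zero n) = y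
  rw [Ext.comp_assoc_of_second_deg_zero, Ext.mk₀_comp_mk₀, e.inv_hom_id, Ext.comp_mk₀_id]

variable {T : ShortComplex (ModuleCat.{u} R)} (hT : T.ShortExact)
include hT

theorem ext_exact_middle (n : ℕ) : Function.Exact
    ((Ext.mk₀ T.f).postcompOfLinear R L (add_zero n))
    ((Ext.mk₀ T.g).postcompOfLinear R L (add_zero n)) := by
  refine fun x => ⟨fun h => Ext.covariant_sequence_exact₂ L hT x h, ?_⟩
  rintro ⟨y, rfl⟩
  change (y.comp (Ext.mk₀ T.f) (add_zero n)).comp (Ext.mk₀ T.g) (add_zero n) = 0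
  rw [Ext.comp_assoc_of_second_deg_zero, Ext.mk₀_comp_mk₀, T.zero, Ext.mk₀_zero, Ext.comp_zero]

theorem ext_exact_right (n : ℕ) : Function.Exact
    ((Ext.mk₀ T.g).postcompOfLinear R L (add_zero n))
    (hT.extClass.postcompOfLinear R L (rfl : n + 1 = n + 1)) := by
  refine fun x => ⟨fun h => Ext.covariant_sequence_exact₃ L hT x rfl h, ?_⟩
  rintro ⟨y, rfl⟩
  change (y.comp (Ext.mk₀ T.g) (add_zero n)).comp hT.extClass rfl = 0
  rw [Ext.comp_assoc_of_second_deg_zero, hT.comp_extClass, Ext.comp_zero]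

theorem serre_ext_middle {n : ℕ} (h₁ : S (ModuleCat.of R (Ext L T.X₁ n)))
    (h₃ : S (ModuleCat.of R (Ext L T.X₃ n))) : S (ModuleCat.of R (Ext L T.X₂ n)) :=
  serre_of_exact S _ _ (ext_exact_middle L hT n) h₁ h₃

theorem serre_ext_right {n : ℕ} (h₂ : S (ModuleCat.of R (Ext L T.X₂ n)))
    (h₁ : S (ModuleCat.of R (Ext L T.X₁ (n + 1)))) : S (ModuleCat.of R (Ext L T.X₃ n)) :=
  serre_of_exact S _ _ (ext_exact_right L hT n) h₂ h₁

end Ext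

/-! ### Cycles and boundaries of a complex of injective modules -/

namespace CochainComplex

open Abelian HomologicalComplex

variable {R : Type u} [CommRing R] (K : CochainComplex (ModuleCat.{u} R) ℕ)

/-- The module of `j`-boundaries of `K`, as a submodule of the `j`-cycles: the kernel of the
projection of the cycles onto the homology. -/
noncomputable abbrev boundaries (j : ℕ) : Submodule R (K.cycles j) :=
  LinearMap.ker (K.homologyπ j).hom

theorem shortExact_boundaries_cycles_homology (j : ℕ) :
    (K.homologyπ j).hom.shortComplexKer.ShortExact :=
  LinearMap.shortExact_shortComplexKer
    ((ModuleCat.epi_iff_surjective (K.homologyπ j)).mp inferInstance)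

theorem exact_toCycles_homologyπ (j : ℕ) :
    Function.Exact (K.toCycles j (j + 1)) (K.homologyπ (j + 1)) :=
  (ShortComplex.ShortExact.moduleCat_exact_iff_function_exact _).mp
    (ShortComplex.exact_of_g_is_cokernel
      (ShortComplex.mk (K.toCycles j (j + 1)) (K.homologyπ (j + 1)) (by simp))
      (K.homologyIsCokernel j (j + 1) (by simp)))

theorem exact_iCycles_toCycles (j : ℕ) :
    Function.Exact (K.iCycles j) (K.toCycles j (j + 1)) := by
  have h : Function.Exact (K.iCycles j) (K.d j (j + 1)) :=
    (ShortComplex.ShortExact.moduleCat_exact_iff_function_exact _).mp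
      (ShortComplex.exact_of_f_is_kernel
        (ShortComplex.mk (K.iCycles j) (K.d j (j + 1)) (by simp))
        (K.cyclesIsKernel j (j + 1) (by simp)))
  have hinj : Function.Injective (K.iCycles (j + 1)) :=
    (ModuleCat.mono_iff_injective _).mp inferInstance
  intro x
  rw [← h x, ← K.toCycles_i j (j + 1), ModuleCat.comp_apply, map_eq_zero_iff _ hinj]

/-- The surjection of `K.X j` onto the `(j + 1)`-boundaries, as a short complex with first
term the `j`-cycles. -/
noncomputable abbrev cyclesShortComplex (j : ℕ) : ShortComplex (ModuleCat.{u} R) where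
  f := K.iCycles j
  g := ModuleCat.ofHom ((K.toCycles j (j + 1)).hom.codRestrict (K.boundaries (j + 1))
    fun x => (K.exact_toCycles_homologyπ j).apply_apply_eq_zero x)
  zero := ModuleCat.hom_ext (LinearMap.ext fun x =>
    Subtype.ext ((K.exact_iCycles_toCycles j).apply_apply_eq_zero x))

theorem shortExact_cyclesShortComplex (j : ℕ) : (K.cyclesShortComplex j).ShortExact := by
  refine ModuleCat.shortComplex_shortExact _ (fun x => ?_)
    ((ModuleCat.mono_iff_injective (K.iCycles j)).mp inferInstance) ?_
  · exact Subtype.ext_iff.trans (K.exact_iCycles_toCycles j x)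
  · rintro ⟨y, hy⟩
    obtain ⟨x, rfl⟩ := (K.exact_toCycles_homologyπ j y).mp hy
    exact ⟨x, rfl⟩

theorem shortExact_cycles_of_exactAt (j : ℕ) (h : K.ExactAt (j + 1)) :
    (ShortComplex.mk (K.iCycles j) (K.toCycles j (j + 1))
      (by simp [← cancel_mono (K.iCycles (j + 1))])).ShortExact := by
  refine ModuleCat.shortComplex_shortExact _ (K.exact_iCycles_toCycles j)
    ((ModuleCat.mono_iff_injective (K.iCycles j)).mp inferInstance) (fun y => ?_)
  refine (K.exact_toCycles_homologyπ j y).mp ?_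
  have := ModuleCat.subsingleton_of_isZero h.isZero_homology
  exact Subsingleton.elim _ _

instance subsingleton_boundaries_zero : Subsingleton (K.boundaries 0) := by
  have : IsIso (K.homologyπ 0) := K.isIso_homologyπ _ 0 rfl (by simp)
  have h : Function.Injective (K.homologyπ 0) :=
    (ModuleCat.mono_iff_injective _).mp inferInstance
  rw [Submodule.subsingleton_iff_eq_bot]
  exact LinearMap.ker_eq_bot.mpr h

variable (L : ModuleCat.{u} R) (S : ObjectProperty (ModuleCat.{u} R)) [S.IsSerreClass]

/-- In a complex of injectives, passing from the `i`-boundaries to the `i`-cycles only involves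
the `i`-th homology, and passing from the `i`-cycles to the `(i + 1)`-boundaries lowers the
degree of `Ext` by one. -/
theorem serre_ext_boundaries (hK : ∀ n, Injective (K.X n)) (t j : ℕ) (hj : j ≤ t)
    (h : ∀ i < j, S (ModuleCat.of R (Ext L (K.homology i) (t + 1 - i)))) :
    S (ModuleCat.of R (Ext L (ModuleCat.of R (K.boundaries j)) (t + 1 - j))) := by
  induction j with
  | zero =>
    have : Injective (ModuleCat.of R (K.boundaries 0)) :=
      (ModuleCat.isZero_of_subsingleton _).injective
    have := Ext.subsingleton_of_injective L (ModuleCat.of R (K.boundaries 0)) t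
    exact serre_of_subsingleton S _
  | succ j ih =>
    have hZ : S (ModuleCat.of R (Ext L (K.cycles j) (t + 1 - j))) :=
      serre_ext_middle L S (K.shortExact_boundaries_cycles_homology j)
        (ih (by omega) fun i hi => h i (by omega)) (h j (by omega))
    obtain ⟨n, hn⟩ : ∃ n, t + 1 - j = n + 1 + 1 := ⟨t - j - 1, by omega⟩
    rw [hn] at hZ
    rw [show t + 1 - (j + 1) = n + 1 by omega]
    have := hK j
    have := Ext.subsingleton_of_injective L (K.X j) n
    exact serre_ext_right L S (K.shortExact_cyclesShortComplex j) (serre_of_subsingleton S _) hZ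

/-- Let `C → P` be a degreewise monomorphism of complexes of injectives that induces bijections
`Hom(L, C^n) = Hom(L, P^n)`, where `P` is exact in positive degrees. In the exact sequence
`Hom(L, Z^t(C)) → Hom(L, H^t(C)) → Ext¹(L, B^t(C))` the last term is controlled by the lower homology
of `C`, and the first map kills the kernel of the connecting map
`Hom(L, Z^t(C)) → Hom(L, Z^t(P)) → Ext¹(L, Z^{t-1}(P))` (of `Hom(L, Z^0(C)) → Hom(L, H^0(P))` if
`t = 0`). The groups `Hom(L, -)` appear as `Ext^0`. -/
theorem serre_ext_zero_homology {C P : CochainComplex (ModuleCat.{u} R) ℕ} (ι : C ⟶ P)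
    (hι : ∀ n, Mono (ι.f n)) (hC : ∀ n, Injective (C.X n)) (hP : ∀ n, Injective (P.X n))
    (hlift : ∀ n (g : L ⟶ P.X n), ∃ g' : L ⟶ C.X n, g' ≫ ι.f n = g)
    (hex : ∀ n, P.ExactAt (n + 1)) (h0 : ∀ n, S (ModuleCat.of R (Ext L (P.homology 0) n)))
    (t : ℕ) (h : ∀ j < t, S (ModuleCat.of R (Ext L (C.homology j) (t + 1 - j)))) :
    S (ModuleCat.of R (Ext L (C.homology t) 0)) := by
  have hB : S (ModuleCat.of R (Ext L (ModuleCat.of R (C.boundaries t)) (0 + 1))) := by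
    have := C.serre_ext_boundaries L S hC t t le_rfl h
    rwa [show t + 1 - t = 0 + 1 by omega] at this
  have hH : ∀ i n, S (ModuleCat.of R (Ext L (P.homology i) (n + 1))) := by
    rintro (_ | i) n
    · exact h0 _
    · have : Injective (P.homology (i + 1)) := (hex i).isZero_homology.injective
      have := Ext.subsingleton_of_injective L (P.homology (i + 1)) n
      exact serre_of_subsingleton S _
  have hmono : ∀ n {f g : L ⟶ C.cycles n}, f ≫ cyclesMap ι n = g ≫ cyclesMap ι n → f = g := by
    intro n f g hfg
    have := hι n
    rw [← cancel_mono (C.iCycles n), ← cancel_mono (ι.f n)]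
    simpa using hfg =≫ P.iCycles n
  have hexact := ext_exact_right L (C.shortExact_boundaries_cycles_homology t) 0
  obtain _ | t := t
  · refine serre_of_exact_of_ker_le S _ _ hexact
      ((Ext.mk₀ (cyclesMap ι 0 ≫ P.homologyπ 0)).postcompOfLinear R L (add_zero 0)) ?_ (h0 0) hB
    intro x hx
    obtain ⟨f, rfl⟩ := Ext.linearEquiv₀ (R := R) |>.symm.surjective x
    have : IsIso (P.homologyπ 0) := P.isIso_homologyπ _ 0 rfl (by simp)
    have hf : f = 0 := by
      refine hmono 0 ?_
      rw [← cancel_mono (P.homologyπ 0)]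
      simpa using hx
    rw [hf, map_zero]
    exact zero_mem _
  · have hZ : S (ModuleCat.of R (Ext L (P.cycles t) (0 + 1))) := by
      have := P.serre_ext_boundaries L S hP t t le_rfl fun i hi => by
        rw [show t + 1 - i = (t - i) + 1 by omega]; exact hH _ _
      rw [show t + 1 - t = 0 + 1 by omega] at this
      exact serre_ext_middle L S (P.shortExact_boundaries_cycles_homology t) this (hH _ _)
    have hT := P.shortExact_cycles_of_exactAt t (hex t)
    refine serre_of_exact_of_ker_le S _ _ hexact
      ((hT.extClass.postcompOfLinear R L (rfl : 0 + 1 = 0 + 1)) ∘ₗ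
        ((Ext.mk₀ (cyclesMap ι (t + 1))).postcompOfLinear R L (add_zero 0))) ?_ hZ hB
    intro x hx
    obtain ⟨f, rfl⟩ := Ext.linearEquiv₀ (R := R) |>.symm.surjective x
    obtain ⟨y, hy⟩ := (ext_exact_right L hT 0 _).mp hx
    obtain ⟨g, rfl⟩ := Ext.linearEquiv₀ (R := R) |>.symm.surjective y
    obtain ⟨g, rfl⟩ := hlift t g
    have hf : f = g ≫ C.toCycles t (t + 1) := by
      refine hmono (t + 1) ?_
      have hnat : C.toCycles t (t + 1) ≫ cyclesMap ι (t + 1) = ι.f t ≫ P.toCycles t (t + 1) := by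
        simp [← cancel_mono (P.iCycles (t + 1))]
      apply (Ext.linearEquiv₀ (R := R)).symm.injective
      simpa [hnat] using hy.symm
    simp [hf]

end CochainComplex

/-! ### The torsion functor on injective modules -/

namespace PairOfIdeals

variable {R : Type u} [CommRing R] (I J : Ideal R)

theorem mem_torsion_iff {M : Type u} [AddCommGroup M] [Module R M] {x : M} :
    x ∈ torsion I J M ↔ ∀ p : PrimeSpectrum R, p ∉ W I J → ∃ a ∉ p.asIdeal, a • x = 0 := by
  refine ⟨fun h p hp => ?_, fun h p hp => ?_⟩
  · obtain ⟨a, ha, hax⟩ := Module.notMem_support_iff'.mp (fun hs => hp (h hs))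
      ⟨x, Submodule.mem_span_singleton_self x⟩
    exact ⟨a, ha, congrArg Subtype.val hax⟩
  · by_contra hW
    obtain ⟨a, ha, hax⟩ := h p hW
    obtain ⟨⟨z, hz⟩, hz'⟩ := Module.mem_support_iff'.mp hp
    obtain ⟨c, rfl⟩ := Submodule.mem_span_singleton.mp hz
    refine hz' a ha (Subtype.ext ?_)
    change a • c • x = 0
    rw [smul_comm, hax, smul_zero]

variable {I J}

/-- The torsion submodule contains everything annihilated by an ideal whose zero locus lies in
`W(I, J)`. -/
theorem mem_torsion_of_forall_smul_eq_zero {M : Type u} [AddCommGroup M] [Module R M] {b : Ideal R}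
    (hb : PrimeSpectrum.zeroLocus (b : Set R) ⊆ W I J) {x : M} (hx : ∀ a ∈ b, a • x = 0) :
    x ∈ torsion I J M := by
  refine (mem_torsion_iff I J).mpr fun p hp => ?_
  obtain ⟨a, ha, hap⟩ := Set.not_subset.mp fun h : (b : Set R) ⊆ p.asIdeal => hp (hb h)
  exact ⟨a, hap, hx a ha⟩

/-- A finitely generated torsion module is annihilated by an ideal whose zero locus lies in
`W(I, J)`. -/
theorem zeroLocus_annihilator_subset_W {M : Type u} [AddCommGroup M] [Module R M]
    {N : Submodule R M} (hN : N.FG) (h : N ≤ torsion I J M) :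
    PrimeSpectrum.zeroLocus (N.annihilator : Set R) ⊆ W I J := by
  have : Module.Finite R N := Module.Finite.iff_fg.mpr hN
  intro p hp
  change p ∈ PrimeSpectrum.zeroLocus (Module.annihilator R N : Set R) at hp
  rw [← Module.support_eq_zeroLocus, Module.mem_support_iff'] at hp
  obtain ⟨x, hx⟩ := hp
  by_contra hW
  obtain ⟨a, ha, hax⟩ := (mem_torsion_iff I J).mp (h x.2) p hW
  exact hx a ha (Subtype.ext hax)

/-- Over a noetherian ring `Γ_{I,J}` preserves injectives. Let `e : R → E` and an ideal `a` with
`a e` torsion be given, and let `b` be the annihilator of `a e`. By Artin–Rees `b ^ n e` meets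
`a e` in `0`, so the inclusion of `a e` extends to a map `R e / b ^ n e → E`, and the image of `e`
under this map is torsion. -/
theorem injective_torsion [IsNoetherianRing R] (E : Type u) [AddCommGroup E] [Module R E]
    [hE : Module.Injective R E] : Module.Injective R (torsion I J E) := by
  refine Module.Baer.injective fun a f => ?_
  obtain ⟨g, hg⟩ := Module.Baer.of_injective hE a ((torsion I J E).subtype ∘ₗ f)
  -- `D = R e`, `A = a e ⊆ D`
  let D := LinearMap.range g
  let A : Submodule R D := Submodule.map g.rangeRestrict a
  have hA : A.map D.subtype ≤ torsion I J E := by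
    rintro _ ⟨_, ⟨x, hx, rfl⟩, rfl⟩
    change g x ∈ _
    rw [hg x hx]
    exact (f ⟨x, hx⟩).2
  let b := (A.map D.subtype).annihilator
  have hb : PrimeSpectrum.zeroLocus (b : Set R) ⊆ W I J :=
    zeroLocus_annihilator_subset_W ((IsNoetherian.noetherian A).map _) hA
  obtain ⟨k, hk⟩ := b.exists_pow_inf_eq_pow_smul A
  have hdisj : b ^ (k + 1) • (⊤ : Submodule R D) ⊓ A = ⊥ := by
    rw [hk (k + 1) (Nat.le_succ k), Nat.add_sub_cancel_left, pow_one, eq_bot_iff]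
    refine (Submodule.smul_mono le_rfl inf_le_right).trans ?_
    refine Submodule.smul_le.mpr fun r hr x hx => ?_
    exact Subtype.ext (Submodule.mem_annihilator.mp hr x ⟨x, hx, rfl⟩)
  let Q := b ^ (k + 1) • (⊤ : Submodule R D)
  obtain ⟨h, hh⟩ := hE.out (Q.mkQ ∘ₗ A.subtype) (by
    rw [← LinearMap.ker_eq_bot, LinearMap.ker_comp, Submodule.ker_mkQ,
      ← Submodule.disjoint_iff_comap_eq_bot, disjoint_iff, inf_comm]
    exact hdisj) (D.subtype ∘ₗ A.subtype)
  have hpow : PrimeSpectrum.zeroLocus ((b ^ (k + 1) : Ideal R) : Set R) ⊆ W I J := by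
    rwa [PrimeSpectrum.zeroLocus_pow _ k.succ_ne_zero]
  let ψ : R →ₗ[R] E := h ∘ₗ Q.mkQ ∘ₗ g.rangeRestrict
  have hψ : ∀ r, ψ r ∈ torsion I J E := fun r =>
    mem_torsion_of_forall_smul_eq_zero hpow fun c hc => by
      have : Q.mkQ (c • g.rangeRestrict r) = 0 :=
        (Submodule.Quotient.mk_eq_zero _).mpr (Submodule.smul_mem_smul hc trivial)
      change c • h (Q.mkQ (g.rangeRestrict r)) = 0
      rw [← map_smul, ← map_smul, this, map_zero]
  refine ⟨ψ.codRestrict _ hψ, fun x hx => Subtype.ext ?_⟩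
  exact (hh ⟨g.rangeRestrict x, x, hx, rfl⟩).trans (hg x hx)

/-- For a maximal ideal `m ∈ W(I, J)`, homomorphisms from `R / m` have torsion image. -/
theorem apply_mem_torsion_of_mem_W {m : MaximalSpectrum R} (hm : m.toPrimeSpectrum ∈ W I J)
    {M : Type u} [AddCommGroup M] [Module R M] (f : (R ⧸ m.asIdeal) →ₗ[R] M) (x : R ⧸ m.asIdeal) :
    f x ∈ torsion I J M := by
  refine mem_torsion_of_forall_smul_eq_zero (b := m.asIdeal) (fun p hp => ?_) fun a ha => ?_
  · have : p = m.toPrimeSpectrum :=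
      PrimeSpectrum.ext (m.isMaximal.eq_of_le p.isPrime.ne_top hp).symm
    rwa [this]
  · obtain ⟨r, rfl⟩ := Ideal.Quotient.mk_surjective x
    have : a • Ideal.Quotient.mk m.asIdeal r = 0 :=
      Ideal.Quotient.eq_zero_iff_mem.mpr (m.asIdeal.mul_mem_right r ha)
    rw [← map_smul, this, map_zero]

end PairOfIdeals

/-! ### `Ext` from a residue field into a minimax module -/

section Minimax

open Abelian

variable {R : Type u} [CommRing R]

theorem isArtinian_ext [IsNoetherianRing R] (L A : ModuleCat.{u} R) [Module.Finite R L]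
    [IsArtinian R A] (i : ℕ) : IsArtinian R (Ext L A i) := by
  induction i generalizing L with
  | zero =>
    obtain ⟨n, f, hf⟩ := Module.Finite.exists_fin' R L
    let ev : (L →ₗ[R] A) →ₗ[R] (Fin n → A) :=
      LinearMap.pi fun i => LinearMap.applyₗ (f (Pi.single i 1))
    have hev : Function.Injective ev := fun φ ψ h => by
      have h' : φ ∘ₗ f = ψ ∘ₗ f :=
        LinearMap.pi_ext' fun i => LinearMap.ext_ring (congrFun h i)
      exact (LinearMap.cancel_right hf).mp h'
    have h : IsArtinian R (L →ₗ[R] A) := isArtinian_of_injective ev hev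
    exact ((Ext.linearEquiv₀ (R := R)).trans ModuleCat.homLinearEquiv).isArtinian_iff.mpr h
  | succ n ih =>
    obtain ⟨F, _, _, _, _, f, hf⟩ := Module.exists_finite_presentation R L
    let hs := LinearMap.shortExact_shortComplexKer hf
    have := ih (ModuleCat.of R (LinearMap.ker f))
    exact isArtinian_of_surjective _ (hs.extClass.precompOfLinear R A (add_comm 1 n))
      (precomp_extClass_surjective_of_projective_X₂ A hs n)

theorem smul_ext_eq_zero {L : ModuleCat.{u} R} (X : ModuleCat.{u} R) {n : ℕ} {r : R}
    (hr : r ∈ Module.annihilator R L) (x : Ext L X n) : r • x = 0 := by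
  have h : r • 𝟙 L = 0 := by
    simp [← ModuleCat.lsmul_eq_smul_id, Module.mem_annihilator_iff_lsmul_eq_zero.mp hr]
  have h' : r • x = (Ext.mk₀ (r • 𝟙 L)).comp x (zero_add n) := by simp [Ext.mk₀_smul]
  rw [h', h, Ext.mk₀_zero, Ext.zero_comp]

/-- A module killed by `m` is a vector space over `R / m`, hence semisimple, and for semisimple
modules the noetherian and the artinian condition agree. -/
theorem isFiniteLength_of_smul_eq_zero (m : MaximalSpectrum R) (V : Type u) [AddCommGroup V]
    [Module R V] (hV : ∀ r ∈ m.asIdeal, ∀ v : V, r • v = 0)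
    (h : IsNoetherian R V ∨ IsArtinian R V) : IsFiniteLength R V := by
  have hV' : Module.IsTorsionBySet R V m.asIdeal := fun v r => hV r r.2 v
  have := m.isMaximal
  let := Ideal.Quotient.field m.asIdeal
  let := hV'.module
  have : IsSemisimpleModule R V := hV'.isSemisimpleModule_iff.mp inferInstance
  obtain h | h := h
  · exact (IsSemisimpleModule.finite_tfae.out 1 3).mp h
  · exact (IsSemisimpleModule.finite_tfae.out 2 3).mp h

/-- `Ext` from `R / m` into a finitely generated or an artinian module is noetherian or artinian,
and it is killed by `m`; so it has finite length. -/
theorem serre_ext_of_isMinimax [IsNoetherianRing R] (S : ObjectProperty (ModuleCat.{u} R))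
    [S.IsSerreClass] (hS : ∀ m : MaximalSpectrum R, S (ModuleCat.of R (R ⧸ m.asIdeal)))
    (M : ModuleCat.{u} R) (hM : IsMinimax R M) (m : MaximalSpectrum R) (n : ℕ) :
    S (ModuleCat.of R (Ext (ModuleCat.of R (R ⧸ m.asIdeal)) M n)) := by
  obtain ⟨N, hN, hq⟩ := hM
  have hkill : ∀ X : ModuleCat.{u} R, ∀ r ∈ m.asIdeal,
      ∀ x : Ext (ModuleCat.of R (R ⧸ m.asIdeal)) X n, r • x = 0 := fun X r hr x =>
    smul_ext_eq_zero X (by rwa [Ideal.annihilator_quotient]) x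
  have := Module.Finite.iff_fg.mpr hN
  refine serre_ext_middle _ S (T := ModuleCat.shortComplexOfCompEqZero N.subtype N.mkQ
    (LinearMap.exact_subtype_mkQ N).linearMap_comp_eq_zero) (ModuleCat.shortComplex_shortExact _
      (LinearMap.exact_subtype_mkQ N) N.injective_subtype N.mkQ_surjective) ?_ ?_
  · exact serre_of_isFiniteLength S hS (isFiniteLength_of_smul_eq_zero m _ (hkill _)
      (Or.inl (isNoetherian_of_isNoetherianRing_of_finite R _)))
  · exact serre_of_isFiniteLength S hS (isFiniteLength_of_smul_eq_zero m _ (hkill _)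
      (Or.inr (isArtinian_ext _ (ModuleCat.of R (M ⧸ N)) n)))

end Minimax

/-! ### Homomorphisms from a residue field into local cohomology -/

namespace PairOfIdeals

open Abelian

variable {R : Type u} [CommRing R]

/-- The inclusion of `Γ_{I,J}(K)` into a complex `K`. -/
noncomputable def torsionComplexι (I J : Ideal R) (K : CochainComplex (ModuleCat.{u} R) ℕ) :
    ((torsionFunctor I J).mapHomologicalComplex _).obj K ⟶ K where
  f n := ModuleCat.ofHom (torsion I J (K.X n)).subtype

/-- A Serre class containing all `Ext^n(R / m, M)` and, for `j < t`, all
`Ext^{t + 1 - j}(R / m, H^j_{I,J}(M))` contains `Hom(R / m, H^t_{I,J}(M))`, in the form of `Ext^0`: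
the complex `Γ_{I,J}(P)`, for `P` an injective resolution of `M`, consists of injectives and has the
same homomorphisms from `R / m` as `P`. -/
theorem serre_ext_zero_localCohomology [IsNoetherianRing R] (I J : Ideal R)
    (S : ObjectProperty (ModuleCat.{u} R)) [S.IsSerreClass] (M : ModuleCat.{u} R)
    (m : MaximalSpectrum R) (hm : m.toPrimeSpectrum ∈ W I J)
    (hM : ∀ n, S (ModuleCat.of R (Ext (ModuleCat.of R (R ⧸ m.asIdeal)) M n))) (t : ℕ)
    (h : ∀ j < t, S (ModuleCat.of R
      (Ext (ModuleCat.of R (R ⧸ m.asIdeal)) (localCohomology I J j M) (t + 1 - j)))) :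
    S (ModuleCat.of R (Ext (ModuleCat.of R (R ⧸ m.asIdeal)) (localCohomology I J t M) 0)) := by
  let P := injectiveResolution M
  let e : ∀ j, localCohomology I J j M ≅
      (((torsionFunctor I J).mapHomologicalComplex _).obj P.cocomplex).homology j :=
    fun j => P.isoRightDerivedObj (torsionFunctor I J) j
  let e₀ : M ≅ P.cocomplex.homology 0 :=
    (HomologicalComplex.singleObjHomologySelfIso (ComplexShape.up ℕ) 0 M).symm ≪≫
      isoOfQuasiIsoAt P.ι 0
  refine serre_ext_of_iso _ S (e t).symm
    (CochainComplex.serre_ext_zero_homology _ S (torsionComplexι I J P.cocomplex)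
      (fun n => ?_) (fun n => ?_) P.injective (fun n g => ?_) P.cocomplex_exactAt_succ
      (fun n => serre_ext_of_iso _ S e₀ (hM n)) t
      fun j hj => serre_ext_of_iso _ S (e j) (h j hj))
  · exact (ModuleCat.mono_iff_injective _).mpr (torsion I J (P.cocomplex.X n)).injective_subtype
  · have : Module.Injective R (P.cocomplex.X n) :=
      Module.injective_module_of_injective_object R _ (inj := P.injective n)
    have := injective_torsion (I := I) (J := J) (P.cocomplex.X n)
    exact Module.injective_object_of_injective_module R (torsion I J (P.cocomplex.X n))
  · exact ⟨ModuleCat.ofHom (g.hom.codRestrict _ (apply_mem_torsion_of_mem_W hm g.hom)), rfl⟩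

end PairOfIdeals

theorem theorem2p12 {R : Type u} [CommRing R] [IsNoetherianRing R] (I J : Ideal R)
    (S : ObjectProperty (ModuleCat.{u} R)) [S.IsSerreClass]
    (hS : ∀ m : MaximalSpectrum R, S (ModuleCat.of R (R ⧸ m.asIdeal)))
    (M : ModuleCat.{u} R) (hM : IsMinimax R M) (t : ℕ)
    (hExt : ∀ n : ℕ, (n = t ∨ n = t + 1) → ∀ j : ℕ, j < t → ∀ m : MaximalSpectrum R,
      S (extModule (R := R) (R ⧸ m.asIdeal) (PairOfIdeals.localCohomology I J j M) (n - j)))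
    (N : Submodule R (PairOfIdeals.localCohomology I J t M))
    (m : MaximalSpectrum R) (hm : m.toPrimeSpectrum ∈ PairOfIdeals.W I J)
    (hN : S (extModule (R := R) (R ⧸ m.asIdeal) N 1)) :
    S (ModuleCat.of R
      ((R ⧸ m.asIdeal) →ₗ[R] (PairOfIdeals.localCohomology I J t M ⧸ N))) := by
  have hH := PairOfIdeals.serre_ext_zero_localCohomology I J S M m hm
    (serre_ext_of_isMinimax S hS M hM m) t fun j hj => hExt (t + 1) (Or.inr rfl) j hj m
  have h := serre_ext_right (ModuleCat.of R (R ⧸ m.asIdeal)) S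
    (T := ModuleCat.shortComplexOfCompEqZero N.subtype N.mkQ
      (LinearMap.exact_subtype_mkQ N).linearMap_comp_eq_zero)
    (ModuleCat.shortComplex_shortExact _ (LinearMap.exact_subtype_mkQ N) N.injective_subtype
      N.mkQ_surjective) (n := 0) hH hN
  let e : Abelian.Ext (ModuleCat.of R (R ⧸ m.asIdeal))
      (ModuleCat.of R (PairOfIdeals.localCohomology I J t M ⧸ N)) 0 ≃ₗ[R]
      ((R ⧸ m.asIdeal) →ₗ[R] (PairOfIdeals.localCohomology I J t M ⧸ N)) :=
    (Abelian.Ext.linearEquiv₀ (R := R)).trans ModuleCat.homLinearEquiv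
  exact serre_of_surjective S e.toLinearMap e.surjective h
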